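/- **Conventions.** A ribbon graph is a finite graph (loops and multiple edges allowed) with a cyclic order of the half-edges at each vertex; its faces are its boundary components (an isolated vertex has one face), and the degree of a face is the number of edge sides along it. Subgraphs carry the induced cyclic orders. An edge $e$ of a ribbon graph $G^*$ is *static* if some connected component of $G^*-e$ is bipartite; for connected $G^*$ it is a *bridge* if $G^*-e$ is disconnected. **Proposition 6.5.** Let $\mu=(m_1,m_2)$ with $m_1,m_2$ odd, and let $G^*$ be a connected (dual) ribbon graph with exactly two faces, of degrees $m_1+2$ and $m_2+2$ (such a graph is never bipartite). Let $Z$ be a set of static edges of $G^*$, for instance the set $E_{\rm stat}(G^*)$ of all static edges, or the set of static edges that degenerate to length zero, and suppose that $Z$ contains a non-bridge edge. Let $G_1^*,\dots,G_h^*$ be the connected components of $G^*-Z$ (the *pieces*), and let $G^*_{\rm stat}$ (the *static graph*) be the multigraph with vertices $G_1^*,\dots,G_h^*$ and edges $Z$. Then: 1. $G^*_{\rm stat}$ contains exactly one cycle (a loop counts as a cycle of length one, a pair of parallel edges as one of length two). The edges of this cycle are precisely the non-bridge edges of $G^*$ in $Z$. 2. Each $G_i^*$ is bipartite and has exactly one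 face. 3. For each $i$, the half-edges of edges in $Z$ attached to $G_i^*$ form a single cycle, in the order in which they are met along the boundary of $G_i^*$. With these cyclic orders $G^*_{\rm stat}$ is a connected ribbon graph of genus zero, i.e. a planar one. 4. Let $W$ be a fixed-point-free involution of the vertex set of $G^*$. Let $w$ be real weights on the edges of $G^*$ with $w(e)=0$ for all $e\in Z$, and let $b_v$ be the sum of the weights of the half-edges at the vertex $v$. Suppose that $b=(b_v)_v$ is a generic point of the wall of $W$: $b_{W(v)}=b_v$ for all $v$, and every relation $\sum_v a_v b_v=0$ with all $a_v\in\{-1,0,1\}$ holds on the whole wall $\{b' : b'_{W(v)}=b'_v \text{ for all } v\}$. Then for every vertex $v$ the vertices $v$ and $W(v)$ lie in the same piece $G_i^*$. -/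

import Mathlib

/-! ### First return permutations -/

section FirstReturn

variable {α : Type*} [Finite α]

theorem exists_first_return (σ : Equiv.Perm α) (p : α → Prop) (x : {a // p a}) :
    ∃ n : ℕ, p ((σ ^ (n + 1)) x.1) := by
  obtain ⟨n, hn, h⟩ := isOfFinOrder_iff_pow_eq_one.mp (isOfFinOrder_of_finite σ)
  obtain ⟨m, rfl⟩ : ∃ m, n = m + 1 := ⟨n - 1, by omega⟩
  exact ⟨m, by rw [h]; exact x.2⟩

open Classical in
/-- The first point of the forward `σ`-orbit `σ x, σ² x, …` of `x` that satisfies `p`. -/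
noncomputable def firstReturnFun (σ : Equiv.Perm α) (p : α → Prop) (x : {a // p a}) :
    {a // p a} :=
  ⟨(σ ^ (Nat.find (exists_first_return σ p x) + 1)) x.1,
    Nat.find_spec (exists_first_return σ p x)⟩

theorem firstReturnFun_injective (σ : Equiv.Perm α) (p : α → Prop) :
    Function.Injective (firstReturnFun σ p) := by
  classical
  have key : ∀ x y : {a // p a}, ∀ m n : ℕ, m ≤ n →
      (∀ k < n, ¬ p ((σ ^ (k + 1)) y.1)) →
      (σ ^ (m + 1)) x.1 = (σ ^ (n + 1)) y.1 → x = y := by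
    intro x y m n hmn hmin h
    have h1 : x.1 = (σ ^ (n - m)) y.1 := by
      have h2 : n + 1 = (m + 1) + (n - m) := by omega
      rw [h2, pow_add (σ) (m + 1) (n - m), Equiv.Perm.mul_apply (σ ^ (m + 1))] at h
      exact (σ ^ (m + 1)).injective h
    rcases Nat.eq_zero_or_pos (n - m) with h0 | h0
    · rw [h0] at h1
      exact Subtype.ext h1
    · exfalso
      refine hmin (n - m - 1) (by omega) ?_
      rw [show n - m - 1 + 1 = n - m by omega, ← h1]
      exact x.2
  intro x y h
  have h' := congrArg Subtype.val h
  rcases le_total (Nat.find (exists_first_return σ p x))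
    (Nat.find (exists_first_return σ p y)) with hle | hle
  · exact key x y _ _ hle (fun k hk => Nat.find_min (exists_first_return σ p y) hk) h'
  · exact (key y x _ _ hle (fun k hk => Nat.find_min (exists_first_return σ p x) hk) h'.symm).symm

/-- The permutation induced by `σ` on a subset: each cycle of `σ` is shortened by skipping the
elements outside the subset. -/
noncomputable def firstReturn (σ : Equiv.Perm α) (p : α → Prop) : Equiv.Perm {a // p a} :=
  Equiv.ofBijective (firstReturnFun σ p)
    (Finite.injective_iff_bijective.mp (firstReturnFun_injective σ p))

theorem firstReturn_sameCycle_iff (σ : Equiv.Perm α) (p : α → Prop) (x y : {a // p a}) :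
    (firstReturn σ p).SameCycle x y ↔ σ.SameCycle x.1 y.1 := by
  classical
  have hstep : ∀ z : {a // p a}, ((firstReturn σ p) z).1 =
      (σ ^ (Nat.find (exists_first_return σ p z) + 1)) z.1 := fun z => rfl
  constructor
  · intro h
    obtain ⟨n, hn⟩ := h.exists_nat_pow_eq
    clear h
    induction n generalizing x with
    | zero => exact ⟨0, by simpa using congrArg Subtype.val hn⟩
    | succ n ih =>
      rw [pow_succ, Equiv.Perm.mul_apply] at hn
      refine Equiv.Perm.SameCycle.trans ?_ (ih _ hn)
      exact ⟨((Nat.find (exists_first_return σ p x) + 1 : ℕ) : ℤ), by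
        rw [zpow_natCast]; exact (hstep x).symm⟩
  · intro h
    obtain ⟨n, hn⟩ := h.exists_nat_pow_eq
    clear h
    induction n using Nat.strong_induction_on generalizing x with
    | _ n ih =>
      rcases Nat.eq_zero_or_pos n with h0 | h0
      · subst h0
        have : x = y := Subtype.ext (by simpa using hn)
        rw [this]
      · have hle : Nat.find (exists_first_return σ p x) ≤ n - 1 :=
          Nat.find_min' _ (by rw [show n - 1 + 1 = n by omega, hn]; exact y.2)
        have h1 : (σ ^ (n - (Nat.find (exists_first_return σ p x) + 1)))
            ((firstReturn σ p) x).1 = y.1 := by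
          rw [hstep, ← Equiv.Perm.mul_apply, ← pow_add, Nat.sub_add_cancel (by omega), hn]
        have h2 := ih _ (by omega) _ h1
        exact Equiv.Perm.SameCycle.trans ⟨1, by simp⟩ h2

end FirstReturn

/-! ### Ribbon graphs -/

/-- A ribbon graph (possibly disconnected; loops, multiple edges and isolated vertices allowed)
with vertex set `V` and edge set `E`. The edge `e` consists of the two half-edges `(e, false)` and
`(e, true)`; `src d` is the vertex to which the half-edge `d` is attached, and `rot` is the
rotation system: its cycles are the cyclic orders of the half-edges around the vertices. -/
structure RibbonGraph (V E : Type*) where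
  src : E × Bool → V
  rot : Equiv.Perm (E × Bool)
  sameCycle_iff : ∀ d d' : E × Bool, rot.SameCycle d d' ↔ src d = src d'

namespace RibbonGraph

/-- Exchanges the two half-edges of each edge outside `Z` and fixes the half-edges of the edges
in `Z`. -/
noncomputable def flipOff {E : Type*} (Z : Set E) : Equiv.Perm (E × Bool) := by
  classical
  exact Function.Involutive.toPerm (fun d => (d.1, if d.1 ∈ Z then d.2 else !d.2)) (by
    intro d
    by_cases h : d.1 ∈ Z <;> simp [h])

/-- The other half of the edge to which a half-edge belongs. -/
def opp {E : Type*} : Equiv.Perm (E × Bool) :=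
  Function.Involutive.toPerm (fun d => (d.1, !d.2)) (by intro d; simp)

variable {V E : Type*} (G : RibbonGraph V E)

/-- Walking along the boundary of a face: run along the half-edge `d` to the other end of its
edge and turn to the next half-edge there. -/
def faceNext : Equiv.Perm (E × Bool) := opp.trans G.rot

/-- The faces (boundary components): the cycles of `faceNext`, and one face for each isolated
vertex. -/
def Face : Type _ :=
  Quotient (Equiv.Perm.SameCycle.setoid G.faceNext) ⊕ {v : V // ∀ d, G.src d ≠ v}

/-- The degree of a face: the number of edge sides along it. -/
noncomputable def faceDegree : G.Face → ℕ
  | Sum.inl q =>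
      Nat.card {d : E × Bool // Quotient.mk (Equiv.Perm.SameCycle.setoid G.faceNext) d = q}
  | Sum.inr _ => 0

/-- Bipartite: the vertices can be coloured with two colours such that the ends of each edge
have different colours (in particular there are no loops). -/
def IsBipartite : Prop :=
  ∃ c : V → Bool, ∀ e : E, c (G.src (e, false)) ≠ c (G.src (e, true))

/-- The simple graph on `V` in which two different vertices are adjacent if some edge outside `Z`
joins them. It has the connected components of `G - Z`. -/
def minus (Z : Set E) : SimpleGraph V :=
  SimpleGraph.fromRel (fun v v' => ∃ e ∉ Z, G.src (e, false) = v ∧ G.src (e, true) = v')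

/-- `G` is connected (in particular non-empty). -/
def IsConnected : Prop := (G.minus ∅).Connected

/-- A connected ribbon graph of genus zero. -/
def IsPlanar : Prop :=
  G.IsConnected ∧ (Nat.card V : ℤ) - (Nat.card E : ℤ) + (Nat.card G.Face : ℤ) = 2

/-- The sub-ribbon graph on a set `VS` of vertices and a set `ES` of edges between them, with the
induced cyclic orders. -/
noncomputable def restrict [Finite E] (VS : Set V) (ES : Set E)
    (h : ∀ d : E × Bool, d.1 ∈ ES → G.src d ∈ VS) : RibbonGraph VS ES where
  src d := ⟨G.src (d.1.1, d.2), h (d.1.1, d.2) d.1.2⟩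
  rot := Equiv.prodSubtypeFstEquivSubtypeProd.permCongr
    (firstReturn G.rot (fun d : E × Bool => d.1 ∈ ES))
  sameCycle_iff d d' := by
    have key : ∀ {α β : Type _} (f : α ≃ β) (τ : Equiv.Perm α) (x y : β),
        (f.permCongr τ).SameCycle x y ↔ τ.SameCycle (f.symm x) (f.symm y) := by
      intro α β f τ x y
      have hp : ∀ n : ℤ, (f.permCongr τ) ^ n = f.permCongr (τ ^ n) := fun n =>
        (map_zpow f.permCongrHom τ n).symm
      constructor
      · rintro ⟨n, hn⟩
        refine ⟨n, ?_⟩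
        rw [hp] at hn
        rw [← hn]; simp
      · rintro ⟨n, hn⟩
        refine ⟨n, ?_⟩
        rw [hp]
        simp [hn]
    rw [key, firstReturn_sameCycle_iff, G.sameCycle_iff, Subtype.mk.injEq]
    rfl

/-- The connected components of `G - Z`. -/
abbrev Piece (Z : Set E) : Type _ := (G.minus Z).ConnectedComponent

/-- The component of `G - Z` that contains the vertex `v`. -/
def pieceOf (Z : Set E) (v : V) : G.Piece Z := (G.minus Z).connectedComponentMk v

theorem pieceOf_eq (Z : Set E) (e : E) (he : e ∉ Z) (b b' : Bool) :
    G.pieceOf Z (G.src (e, b)) = G.pieceOf Z (G.src (e, b')) := by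
  have h : G.pieceOf Z (G.src (e, false)) = G.pieceOf Z (G.src (e, true)) := by
    by_cases hv : G.src (e, false) = G.src (e, true)
    · rw [hv]
    · apply SimpleGraph.ConnectedComponent.sound
      apply SimpleGraph.Adj.reachable
      exact (SimpleGraph.fromRel_adj _ _ _).mpr ⟨hv, Or.inl ⟨e, he, rfl, rfl⟩⟩
  cases b <;> cases b' <;> simp [h]

/-- A component of `G - Z`, as a ribbon graph. -/
noncomputable def piece [Finite E] (Z : Set E) (c : G.Piece Z) :
    RibbonGraph {v : V | G.pieceOf Z v = c}
      {e : E | e ∉ Z ∧ G.pieceOf Z (G.src (e, false)) = c} :=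
  G.restrict _ _ (fun d hd => (G.pieceOf_eq Z d.1 hd.1 d.2 false).trans hd.2)

/-- An edge `e` is static if some connected component of `G - e` is bipartite. -/
def IsStatic [Finite E] (e : E) : Prop := ∃ c : G.Piece {e}, (G.piece {e} c).IsBipartite

/-- An edge `e` (of a connected ribbon graph) is a bridge if `G - e` is disconnected. -/
def IsBridge (e : E) : Prop := ¬ (G.minus {e}).Connected

/-- The multigraph whose vertices are the components of `G - Z` and whose edges are those of `Z`:
an edge in `Z` joins the components that contain its two ends. -/
def contracted (Z : Set E) : Graph (G.Piece Z) E where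
  vertexSet := Set.univ
  edgeSet := Z
  IsLink e x y := e ∈ Z ∧ ∃ b : Bool,
    G.pieceOf Z (G.src (e, b)) = x ∧ G.pieceOf Z (G.src (e, !b)) = y
  isLink_symm e _ := ⟨by
    rintro x y ⟨he, b, hx, hy⟩
    exact ⟨he, !b, hy, by simpa using hx⟩⟩
  eq_or_eq_of_isLink_of_isLink := by
    rintro e x y v w ⟨-, b, rfl, rfl⟩ ⟨-, b', rfl, rfl⟩
    cases b <;> cases b' <;> simp
  edge_mem_iff_exists_isLink e :=
    ⟨fun he => ⟨_, _, he, false, rfl, rfl⟩, fun ⟨_, _, he, _⟩ => he⟩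
  left_mem_of_isLink := by
    intro e x y _
    exact Set.mem_univ x

/-- For a half-edge of an edge in `Z`, attached to a component `P` of `G - Z`, the next such
half-edge along the boundary of `P`: turn around the vertices as prescribed by `G`, run along
each edge of `P` that is met, and stop at the first half-edge of an edge in `Z`. -/
noncomputable def boundaryNext [Finite E] (Z : Set E) : Equiv.Perm (Z × Bool) :=
  Equiv.prodSubtypeFstEquivSubtypeProd.permCongr
    (firstReturn ((flipOff Z).trans G.rot) (fun d : E × Bool => d.1 ∈ Z))

open Classical in
/-- The vertex parameters of edge weights `w`: the sum of the weights of the half-edges at each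
vertex (a loop counts twice). -/
noncomputable def vertexParam [Fintype E] (w : E → ℝ) (v : V) : ℝ :=
  ∑ d : E × Bool, if G.src d = v then w d.1 else 0

end RibbonGraph

/-- `C` is the edge set of a cycle in the multigraph `H`: there are `m + 1 ≥ 1` different vertices
`x 0, …, x m` and different edges `e 0, …, e m`, where `e i` joins `x i` to `x (i + 1)`, with
indices modulo `m + 1` (so a loop is a cycle of length one, and two parallel edges form a cycle of
length two). -/
def Graph.IsCycleEdgeSet {α β : Type*} (H : Graph α β) (C : Set β) : Prop :=
  ∃ (m : ℕ) (x : Fin (m + 1) → α) (e : Fin (m + 1) → β),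
    Function.Injective x ∧ Function.Injective e ∧
    (∀ i, H.IsLink (e i) (x i) (x (i + 1))) ∧ C = Set.range e

/-- The wall of a pairing `W` of the index set: the equations `b i = b (W i)`. -/
def OnWall {V : Type*} (W : Equiv.Perm V) (b : V → ℝ) : Prop := ∀ v, b (W v) = b v

/-- `b` is a generic point of the wall of `W`: it lies on the wall, and every linear relation
between its entries with coefficients in `{-1, 0, 1}` follows from the equations of the wall. -/
def IsGenericOnWall {V : Type*} [Fintype V] (W : Equiv.Perm V) (b : V → ℝ) : Prop :=
  OnWall W b ∧ ∀ a : V → ℝ, (∀ v, a v = -1 ∨ a v = 0 ∨ a v = 1) → ∑ v, a v * b v = 0 →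
    ∀ b' : V → ℝ, OnWall W b' → ∑ v, a v * b' v = 0

/-! ### Cycles of permutations and of first return maps -/

namespace Equiv.Perm

variable {α : Type*}

/-! Everything follows from one non-bridge `e₀` in `Z`. Since it is static and `G - e₀` is
connected, `G - e₀` is bipartite. A face avoiding `e₀` would have even degree, because the colours
alternate along it. So each of the two odd faces contains a side of `e₀`, the two sides of `e₀` lie
on different faces, and deleting `e₀` merges these into a single boundary walk
(`isUnicellularOff_singleton`).

Any other `e` in `Z` separates `G - e₀`: either it is a bridge of `G`, or `G - e` is bipartite too
and the xor of the two colourings exhibits `{e, e₀}` as a cut (`pieceOf_pair_ne`). Deleting a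
separating edge cuts one piece with a single boundary walk into two such pieces. Hence there are
`|Z|` pieces, each with one face (`isUnicellularOff_and_card_piece`). Their boundary walks are the
vertex rotations of the static graph. Its face walks are those of `G` with the edges outside `Z`
skipped, so it has two faces, and `|Z| - |Z| + 2 = 2`.

A path in the static graph avoiding `e₀` closes up with `e₀` to a cycle. A two-valued function on
the pieces cannot change exactly once around a cycle; applied to the cuts `{e}` (bridges) and `{e,
e₀}` (other edges), this determines the edges of every cycle.

For the pairing, the sum of `b` over one piece, signed by colour, vanishes. Genericity then forces
the signs to cancel on `{v, W v}`, so `W v` is in the piece of `v`. -/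

theorem SameCycle.map_eq {β : Type*} {σ : Equiv.Perm α} {x y : α} (h : σ.SameCycle x y)
    (f : α → β) (hf : ∀ z, f (σ z) = f z) : f x = f y := by
  obtain ⟨n, rfl⟩ := h
  induction n using Int.induction_on with
  | zero => simp
  | succ n ih => rw [ih, add_comm, zpow_add, zpow_one, mul_apply, hf]
  | pred n ih =>
    rw [ih, ← hf ((σ ^ (-(n : ℤ) - 1)) x), ← mul_apply, ← zpow_one_add]
    congr 3
    ring

/-- Exchanging the images of two points on different cycles joins these cycles. -/
theorem sameCycle_of_exchange [Finite α] {σ τ : Equiv.Perm α} {a b : α}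
    (h : ¬ σ.SameCycle a b) (hab : τ a = σ b) (hx : ∀ x, x ≠ a → x ≠ b → τ x = σ x) :
    τ.SameCycle a b := by
  by_contra hτ
  -- If `τ` did not join `a` and `b`, the `τ`-walk from `a` would enter the `σ`-cycle of `b` at `σ
  -- b` and follow it all the way round to `b`, meeting neither exceptional point before.
  have key : ∀ n : ℕ, τ.SameCycle a ((σ ^ (n + 1)) b) := by
    intro n
    induction n with
    | zero => exact ⟨1, by simpa using hab⟩
    | succ n ih =>
      rw [pow_succ', mul_apply, ← hx]
      · exact ih.trans ⟨1, by simp⟩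
      · intro ha
        exact h (SameCycle.symm ⟨((n + 1 : ℕ) : ℤ), by rw [zpow_natCast]; exact ha⟩)
      · intro hb
        rw [hb] at ih
        exact hτ ih
  obtain ⟨n, hn, hb⟩ := isOfFinOrder_iff_pow_eq_one.mp (isOfFinOrder_of_finite σ)
  have := key (n - 1)
  rw [Nat.sub_add_cancel hn, hb] at this
  exact hτ this

theorem permCongr_sameCycle_iff {β : Type*} (f : α ≃ β) (τ : Equiv.Perm α) (x y : β) :
    (f.permCongr τ).SameCycle x y ↔ τ.SameCycle (f.symm x) (f.symm y) := by
  have hp : ∀ n : ℤ, (f.permCongr τ) ^ n = f.permCongr (τ ^ n) := fun n =>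
    (map_zpow f.permCongrHom τ n).symm
  refine exists_congr fun n => ?_
  rw [hp, Equiv.permCongr_apply, eq_comm, ← Equiv.symm_apply_eq, eq_comm]

end Equiv.Perm

/-- Compares the walks of a subgraph or a contraction with those of `G`. The starting points may
differ, since only the walks after the first step matter; `q` confines these to the region where the
two permutations agree. -/
theorem firstReturn_eq_of_agree {α : Type*} [Finite α] {σ τ : Equiv.Perm α} {p : α → Prop}
    (q : α → Prop) {x y : {a // p a}} (hxy : σ x.1 = τ y.1) (hq : q (σ x.1))
    (hstep : ∀ z, q z → ¬ p z → σ z = τ z ∧ q (σ z)) :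
    firstReturn σ p x = firstReturn τ p y := by
  classical
  have key : ∀ k : ℕ, (∀ j < k, ¬ p ((σ ^ (j + 1)) x.1)) →
      (σ ^ (k + 1)) x.1 = (τ ^ (k + 1)) y.1 ∧ q ((σ ^ (k + 1)) x.1) := by
    intro k
    induction k with
    | zero => intro _; simpa using ⟨hxy, hq⟩
    | succ k ih =>
      intro hk
      obtain ⟨h1, h2⟩ := ih fun j hj => hk j (by omega)
      obtain ⟨h3, h4⟩ := hstep _ h2 (hk k (by omega))
      rw [pow_succ' _ (k + 1), pow_succ' _ (k + 1), Equiv.Perm.mul_apply, Equiv.Perm.mul_apply,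
        ← h1]
      exact ⟨h3, h4⟩
  have hfind : ∀ k : ℕ, (∀ j < k, ¬ p ((σ ^ (j + 1)) x.1)) → p ((σ ^ (k + 1)) x.1) →
      Nat.find (exists_first_return σ p x) = k ∧ Nat.find (exists_first_return τ p y) = k := by
    intro k hk hp
    refine ⟨(Nat.find_eq_iff _).mpr ⟨hp, hk⟩, (Nat.find_eq_iff _).mpr ⟨?_, fun j hj => ?_⟩⟩
    · rwa [← (key k hk).1]
    · rw [← (key j fun i hi => hk i (by omega)).1]
      exact hk j hj
  have hmin := fun j (hj : j < Nat.find (exists_first_return σ p x)) =>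
    Nat.find_min (exists_first_return σ p x) hj
  have hy := (hfind _ hmin (Nat.find_spec (exists_first_return σ p x))).2
  refine Subtype.ext ?_
  change (σ ^ (Nat.find (exists_first_return σ p x) + 1)) x.1 =
    (τ ^ (Nat.find (exists_first_return τ p y) + 1)) y.1
  rw [hy]
  exact (key _ hmin).1

/-! ### Components and boundary walks after deleting edges -/

namespace RibbonGraph

section Minus

variable {V E : Type*} (G : RibbonGraph V E)

@[simp] theorem opp_apply (d : E × Bool) : opp d = (d.1, !d.2) := rfl

theorem src_rot (d : E × Bool) : G.src (G.rot d) = G.src d :=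
  ((G.sameCycle_iff _ _).mp ⟨1, by simp⟩).symm

/-- Walking along the boundary of `G - Z`, stopping at each half-edge of an edge in `Z`. -/
noncomputable def boundaryStep (Z : Set E) : Equiv.Perm (E × Bool) := (flipOff Z).trans G.rot

theorem boundaryStep_of_mem {Z : Set E} {d : E × Bool} (h : d.1 ∈ Z) :
    G.boundaryStep Z d = G.rot d := by
  exact congrArg G.rot (Prod.ext rfl (if_pos h))

theorem boundaryStep_of_notMem {Z : Set E} {d : E × Bool} (h : d.1 ∉ Z) :
    G.boundaryStep Z d = G.rot (opp d) := by
  exact congrArg G.rot (Prod.ext rfl (if_neg h))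

theorem faceNext_apply (d : E × Bool) : G.faceNext d = G.rot (opp d) := rfl

/-- A function that agrees at the ends of each edge outside `Z` is constant on the components of
`G - Z`. -/
theorem map_eq_of_pieceOf_eq {β : Type*} {Z : Set E} {v v' : V}
    (h : G.pieceOf Z v = G.pieceOf Z v') (f : V → β)
    (hf : ∀ e ∉ Z, f (G.src (e, false)) = f (G.src (e, true))) : f v = f v' := by
  obtain ⟨p⟩ := SimpleGraph.ConnectedComponent.eq.mp h
  clear h
  induction p with
  | nil => rfl
  | cons h p ih =>
    rw [← ih]
    rcases ((SimpleGraph.fromRel_adj _ _ _).mp h).2 with ⟨e, he, rfl, rfl⟩ | ⟨e, he, rfl, rfl⟩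
    · exact hf e he
    · exact (hf e he).symm

theorem pieceOf_eq_of_subset {Z Z' : Set E} (hZ : Z ⊆ Z') {v v' : V}
    (h : G.pieceOf Z' v = G.pieceOf Z' v') : G.pieceOf Z v = G.pieceOf Z v' :=
  G.map_eq_of_pieceOf_eq h _ fun e he => G.pieceOf_eq Z e (fun h => he (hZ h)) _ _

theorem connected_minus_iff (Z : Set E) :
    (G.minus Z).Connected ↔ (∀ v v', G.pieceOf Z v = G.pieceOf Z v') ∧ Nonempty V := by
  rw [SimpleGraph.connected_iff]
  exact and_congr_left fun _ =>
    forall₂_congr fun v v' => SimpleGraph.ConnectedComponent.eq.symm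

theorem exists_pieceOf (Z : Set E) (c : G.Piece Z) : ∃ v, G.pieceOf Z v = c :=
  c.exists_rep

/-- Removing a further edge separates at most the two ends of that edge. -/
theorem pieceOf_insert {Z : Set E} (e : E) {v v' : V} (h : G.pieceOf Z v = G.pieceOf Z v') :
    G.pieceOf (insert e Z) v = G.pieceOf (insert e Z) v' ∨
    (G.pieceOf (insert e Z) v = G.pieceOf (insert e Z) (G.src (e, false)) ∧
      G.pieceOf (insert e Z) v' = G.pieceOf (insert e Z) (G.src (e, true))) ∨
    (G.pieceOf (insert e Z) v = G.pieceOf (insert e Z) (G.src (e, true)) ∧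
      G.pieceOf (insert e Z) v' = G.pieceOf (insert e Z) (G.src (e, false))) := by
  classical
  -- Gluing the component of one end of `e` to that of the other gives a function that agrees across
  -- `e` as well.
  have := G.map_eq_of_pieceOf_eq h (fun u =>
    if G.pieceOf (insert e Z) u = G.pieceOf (insert e Z) (G.src (e, true)) then
      G.pieceOf (insert e Z) (G.src (e, false)) else G.pieceOf (insert e Z) u) (by
    intro e' he'
    by_cases hee : e' = e
    · subst hee
      simp
    · have := G.pieceOf_eq (insert e Z) e' (by simp [hee, he']) false true
      simp only [this])
  split_ifs at this with h1 h2 h2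
  · exact Or.inl (h1.trans h2.symm)
  · exact Or.inr (Or.inr ⟨h1, this.symm⟩)
  · exact Or.inr (Or.inl ⟨this, h2⟩)
  · exact Or.inl this

theorem pieceOf_boundaryStep (Z : Set E) (d : E × Bool) :
    G.pieceOf Z (G.src (G.boundaryStep Z d)) = G.pieceOf Z (G.src d) := by
  by_cases h : d.1 ∈ Z
  · rw [G.boundaryStep_of_mem h, src_rot]
  · rw [G.boundaryStep_of_notMem h, src_rot]
    exact G.pieceOf_eq Z d.1 h _ _

theorem pieceOf_eq_of_sameCycle {Z : Set E} {d d' : E × Bool}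
    (h : (G.boundaryStep Z).SameCycle d d') :
    G.pieceOf Z (G.src d) = G.pieceOf Z (G.src d') :=
  h.map_eq (fun d => G.pieceOf Z (G.src d)) (G.pieceOf_boundaryStep Z)

/-- Every component of `G - Z` that contains an edge end has a single boundary walk. -/
def IsUnicellularOff (Z : Set E) : Prop :=
  ∀ d d' : E × Bool, G.pieceOf Z (G.src d) = G.pieceOf Z (G.src d') →
    (G.boundaryStep Z).SameCycle d d'

/-- Once the walks through the two sides of `e` are identified, the new walks are invariant under
the old step. So an old walk breaks into at most the two walks through the sides of `e`, and these
lie in different components. -/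
theorem isUnicellularOff_insert {Z : Set E} (h : G.IsUnicellularOff Z) {e : E}
    (he : e ∉ Z)
    (hsep : G.pieceOf (insert e Z) (G.src (e, false)) ≠
      G.pieceOf (insert e Z) (G.src (e, true))) :
    G.IsUnicellularOff (insert e Z) := by
  classical
  intro d d' hd
  let q : E × Bool → Quotient (Equiv.Perm.SameCycle.setoid (G.boundaryStep (insert e Z))) :=
    Quotient.mk _
  have hq : ∀ x y, q x = q y ↔ (G.boundaryStep (insert e Z)).SameCycle x y :=
    fun x y => Quotient.eq
  have hq1 : ∀ x, q (G.boundaryStep (insert e Z) x) = q x :=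
    fun x => ((hq _ _).mpr ⟨1, by simp⟩).symm
  have hc := h d d' (G.pieceOf_eq_of_subset (Set.subset_insert e Z) hd)
  have hf := hc.map_eq (fun x => if q x = q (e, true) then q (e, false) else q x) (by
    intro x
    by_cases hx : x.1 = e
    · obtain ⟨e', b⟩ := x
      obtain rfl : e' = e := hx
      have : q (G.boundaryStep Z (e', b)) = q (e', !b) := by
        rw [G.boundaryStep_of_notMem he, ← hq1 (e', !b), G.boundaryStep_of_mem (by simp)]
        rfl
      simp only [this]
      cases b <;> simp
    · have : G.boundaryStep Z x = G.boundaryStep (insert e Z) x := by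
        by_cases hxZ : x.1 ∈ Z
        · rw [G.boundaryStep_of_mem hxZ, G.boundaryStep_of_mem (Or.inr hxZ)]
        · rw [G.boundaryStep_of_notMem hxZ, G.boundaryStep_of_notMem (by simp [hx, hxZ])]
      simp only [this, hq1])
  have hp : ∀ x y, q x = q y → G.pieceOf (insert e Z) (G.src x) =
      G.pieceOf (insert e Z) (G.src y) :=
    fun x y hxy => G.pieceOf_eq_of_sameCycle ((hq x y).mp hxy)
  rw [← hq]
  split_ifs at hf with h1 h2 h2
  · exact h1.trans h2.symm
  · exact absurd ((hp _ _ hf).trans (hd.symm.trans (hp _ _ h1))) hsep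
  · exact absurd ((hp _ _ hf).symm.trans (hd.trans (hp _ _ h2))) hsep
  · exact hf

theorem card_piece_insert [Finite V] {Z : Set E} {e : E} (he : e ∉ Z)
    (hsep : G.pieceOf (insert e Z) (G.src (e, false)) ≠
      G.pieceOf (insert e Z) (G.src (e, true))) :
    Nat.card (G.Piece (insert e Z)) = Nat.card (G.Piece Z) + 1 := by
  classical
  have : Finite (G.Piece (insert e Z)) := Quot.finite _
  have : Finite (G.Piece Z) := Quot.finite _
  let π : G.Piece (insert e Z) → G.Piece Z := SimpleGraph.ConnectedComponent.lift
    (G.pieceOf Z) fun v v' p _ => G.pieceOf_eq_of_subset (Set.subset_insert e Z)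
      (SimpleGraph.ConnectedComponent.eq.mpr ⟨p⟩)
  have hπ : ∀ v, π (G.pieceOf (insert e Z) v) = G.pieceOf Z v := fun v => rfl
  set p := G.pieceOf (insert e Z) (G.src (e, true)) with hp
  -- Only the components of the two ends of `e` have the same image, so dropping one of them makes
  -- the projection bijective.
  have hbij : Function.Bijective fun c : {c // c ≠ p} => π c.1 := by
    constructor
    · rintro ⟨c, hc⟩ ⟨c', hc'⟩ h
      obtain ⟨v, rfl⟩ := G.exists_pieceOf _ c
      obtain ⟨v', rfl⟩ := G.exists_pieceOf _ c'
      simp only [hπ] at h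
      rcases G.pieceOf_insert e h with h | h | h
      · exact Subtype.ext h
      · exact absurd h.2 hc'
      · exact absurd h.1 hc
    · intro c
      obtain ⟨v, rfl⟩ := G.exists_pieceOf _ c
      by_cases hv : G.pieceOf (insert e Z) v = p
      · refine ⟨⟨_, hsep⟩, ?_⟩
        change π _ = _
        rw [hπ, G.pieceOf_eq Z e he false true, ← hπ, ← hπ, hv]
      · exact ⟨⟨_, hv⟩, rfl⟩
  rw [← Nat.card_congr (Equiv.ofBijective _ hbij), ← Finite.card_option,
    Nat.card_congr (Equiv.optionSubtypeNe p)]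

end Minus

end RibbonGraph

/-! ### Parity of faces and deletion of static edges -/

namespace RibbonGraph

section TwoFaces

variable {V E : Type*} (G : RibbonGraph V E)

/-- The vertex colouring `c` is proper on the edges outside `Z`. -/
def IsProperOff (Z : Set E) (c : V → Bool) : Prop :=
  ∀ e ∉ Z, c (G.src (e, false)) ≠ c (G.src (e, true))

variable {G}

theorem IsProperOff.src_ne {Z : Set E} {c : V → Bool} (h : G.IsProperOff Z c) {d : E × Bool}
    (hd : d.1 ∉ Z) : c (G.src (opp d)) = !c (G.src d) := by
  obtain ⟨e, b⟩ := d
  have := h e hd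
  cases b
  · exact Bool.eq_not_of_ne this.symm
  · exact Bool.eq_not_of_ne this

/-- A face whose edges are properly coloured has even degree. -/
theorem even_faceDegree_of_isProperOff [Finite E] {Z : Set E} {c : V → Bool}
    (h : G.IsProperOff Z c) (f : G.Face)
    (hf : ∀ d : E × Bool, d.1 ∈ Z → Sum.inl (Quotient.mk _ d) ≠ f) :
    Even (G.faceDegree f) := by
  classical
  cases nonempty_fintype E
  rcases f with q | v
  · let mk : E × Bool → Quotient (Equiv.Perm.SameCycle.setoid G.faceNext) := Quotient.mk _
    have hmk : ∀ d, mk (G.faceNext d) = mk d :=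
      fun d => Quotient.sound (Equiv.Perm.SameCycle.symm ⟨1, by simp⟩)
    change Even (Nat.card {d : E × Bool // mk d = q})
    rw [Nat.card_eq_fintype_card, Fintype.card_subtype,
      ← Finset.card_filter_add_card_filter_not (fun d => c (G.src d) = true)]
    -- `faceNext` matches the sides that start at one colour with those that start at the other.
    refine ⟨_, congrArg₂ _ rfl (Finset.card_equiv G.faceNext fun d => ?_).symm⟩
    simp only [Finset.mem_filter, Finset.mem_univ, true_and, hmk]
    refine and_congr_right fun hd => ?_
    have hdZ : d.1 ∉ Z := fun hdZ => hf d hdZ (congrArg Sum.inl hd)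
    rw [faceNext_apply, src_rot, h.src_ne hdZ]
    simp
  · exact Even.zero

theorem not_isProperOff_empty [Finite E] {f : G.Face} (hf : Odd (G.faceDegree f))
    (c : V → Bool) : ¬ G.IsProperOff ∅ c := fun h =>
  Nat.not_even_iff_odd.mpr hf
    (even_faceDegree_of_isProperOff h f fun _ hd => absurd hd (Set.notMem_empty _))

/-- If all faces of `G` are odd and the colouring is proper off `e`, then all faces contain `e`. -/
theorem exists_side_of_odd [Finite E] {e : E} {c : V → Bool} (h : G.IsProperOff {e} c)
    {f : G.Face} (hf : Odd (G.faceDegree f)) : ∃ b, Sum.inl (Quotient.mk _ (e, b)) = f := by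
  by_contra! hcon
  refine Nat.not_even_iff_odd.mpr hf (even_faceDegree_of_isProperOff h f ?_)
  rintro ⟨e', b⟩ he
  obtain rfl : e' = e := he
  exact hcon b

/-- Two different faces each need a side of `e`, and there are only two sides. -/
theorem not_sameCycle_sides [Finite E] (face : Fin 2 ≃ G.Face)
    (hface : ∀ i, Odd (G.faceDegree (face i))) {e : E} {c : V → Bool}
    (h : G.IsProperOff {e} c) : ¬ G.faceNext.SameCycle (e, false) (e, true) := by
  intro hs
  obtain ⟨b, hb⟩ := exists_side_of_odd h (hface 0)
  obtain ⟨b', hb'⟩ := exists_side_of_odd h (hface 1)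
  have hq : ∀ b b', (Quotient.mk (Equiv.Perm.SameCycle.setoid G.faceNext) (e, b)) =
      Quotient.mk _ (e, b') := by
    have := Quotient.sound (s := Equiv.Perm.SameCycle.setoid G.faceNext) hs
    intro b b'
    cases b <;> cases b' <;> simp [this]
  have : face 0 = face 1 := by rw [← hb, ← hb', hq b b']
  simpa using face.injective this

theorem exists_side_sameCycle [Finite E] (face : Fin 2 ≃ G.Face)
    (hface : ∀ i, Odd (G.faceDegree (face i))) {e : E} {c : V → Bool}
    (h : G.IsProperOff {e} c) (d : E × Bool) : ∃ b, G.faceNext.SameCycle (e, b) d := by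
  obtain ⟨i, hi⟩ := face.surjective (Sum.inl (Quotient.mk _ d))
  obtain ⟨b, hb⟩ := exists_side_of_odd h (hi ▸ hface i)
  exact ⟨b, Quotient.exact (s := Equiv.Perm.SameCycle.setoid G.faceNext) (Sum.inl_injective hb)⟩

/-- Removing an edge that lies on both of the two faces leaves a single face. -/
theorem isUnicellularOff_singleton [Finite E] (face : Fin 2 ≃ G.Face)
    (hface : ∀ i, Odd (G.faceDegree (face i))) {e : E} {c : V → Bool}
    (h : G.IsProperOff {e} c) : G.IsUnicellularOff {e} := by
  have hstep : ∀ x : E × Bool, x.1 ≠ e → G.boundaryStep {e} x = G.faceNext x :=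
    fun x hx => G.boundaryStep_of_notMem hx
  have hstep' : ∀ b, G.boundaryStep {e} (e, b) = G.faceNext (e, !b) := fun b => by
    rw [G.boundaryStep_of_mem (Set.mem_singleton e), faceNext_apply]
    simp
  -- `boundaryStep {e}` is `faceNext` with the images of the two sides of `e` exchanged.
  have hab : (G.boundaryStep {e}).SameCycle (e, false) (e, true) := by
    refine Equiv.Perm.sameCycle_of_exchange (not_sameCycle_sides face hface h) (hstep' false)
      fun x hx hx' => hstep x ?_
    rintro rfl
    obtain ⟨e, _ | _⟩ := x
    · exact hx rfl
    · exact hx' rfl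
  have hab' : ∀ b b', (G.boundaryStep {e}).SameCycle (e, b) (e, b') := by
    intro b b'
    cases b <;> cases b'
    exacts [.refl _ _, hab, hab.symm, .refl _ _]
  let mk : E × Bool → Quotient (Equiv.Perm.SameCycle.setoid (G.boundaryStep {e})) :=
    Quotient.mk _
  have hmk : ∀ d, mk (G.boundaryStep {e} d) = mk d :=
    fun d => Quotient.sound (Equiv.Perm.SameCycle.symm ⟨1, by simp⟩)
  have hall : ∀ d, mk d = mk (e, false) := by
    intro d
    obtain ⟨b, hb⟩ := exists_side_sameCycle face hface h d
    rw [← hb.map_eq mk ?_]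
    · exact Quotient.sound (hab' _ _)
    · intro z
      by_cases hz : z.1 = e
      · obtain ⟨e', b⟩ := z
        obtain rfl : e' = e := hz
        rw [← Bool.not_not b, ← hstep', hmk, Bool.not_not]
        exact Quotient.sound (hab' _ _)
      · rw [← hstep z hz, hmk]
  intro d d' _
  exact Quotient.exact ((hall d).trans (hall d').symm)

theorem exists_isProperOff_of_isStatic [Finite E] {e : E} (hs : G.IsStatic e)
    (hnb : ¬ G.IsBridge e) : ∃ c, G.IsProperOff {e} c := by
  obtain ⟨p, c, hc⟩ := hs
  have hconn := ((G.connected_minus_iff {e}).mp (not_not.mp hnb)).1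
  have hp : ∀ v, G.pieceOf {e} v = p := by
    obtain ⟨v₀, rfl⟩ := G.exists_pieceOf _ p
    exact fun v => hconn _ _
  exact ⟨fun v => c ⟨v, hp v⟩, fun e' he' => hc ⟨e', he', hp _⟩⟩

theorem pieceOf_ne_of_isBridge (hconn : G.IsConnected) {e : E} (hb : G.IsBridge e) :
    G.pieceOf {e} (G.src (e, false)) ≠ G.pieceOf {e} (G.src (e, true)) := by
  intro h
  obtain ⟨h1, h2⟩ := (G.connected_minus_iff ∅).mp hconn
  refine hb ((G.connected_minus_iff {e}).mpr ⟨fun v v' => ?_, h2⟩)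
  refine G.map_eq_of_pieceOf_eq (h1 v v') _ fun e' _ => ?_
  by_cases he : e' = e
  · rw [he, h]
  · exact G.pieceOf_eq {e} _ he _ _

/-- The edge cut that consists of two edges each of whose removal makes `G` bipartite. -/
theorem exists_cut_of_isProperOff {e e' : E} {c c' : V → Bool} (hne : e ≠ e')
    (hG : ∀ c, ¬ G.IsProperOff ∅ c) (h : G.IsProperOff {e} c) (h' : G.IsProperOff {e'} c') :
    ∃ f : V → Bool, f (G.src (e, false)) ≠ f (G.src (e, true)) ∧
      f (G.src (e', false)) ≠ f (G.src (e', true)) ∧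
      ∀ a, a ≠ e → a ≠ e' → f (G.src (a, false)) = f (G.src (a, true)) := by
  have mono : ∀ {e : E} {c : V → Bool}, G.IsProperOff {e} c →
      c (G.src (e, false)) = c (G.src (e, true)) := by
    intro e c h
    by_contra hc
    refine hG c fun a _ => ?_
    by_cases ha : a = e
    · rwa [ha]
    · exact h a ha
  refine ⟨fun v => xor (c v) (c' v), ?_, ?_, fun a ha ha' => ?_⟩
  · have h1 := mono h
    have h2 := h' e hne
    simpa [h1] using h2
  · have h1 := mono h'
    have h2 := h e' hne.symm
    simpa [h1] using h2
  · have h1 := h a ha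
    have h2 := h' a ha'
    simp only [Bool.eq_not_of_ne h1, Bool.eq_not_of_ne h2, Bool.not_xor_not]

theorem pieceOf_pair_ne [Finite E] (hconn : G.IsConnected) (hG : ∀ c, ¬ G.IsProperOff ∅ c)
    {e e' : E} {c : V → Bool} (hne : e' ≠ e) (h : G.IsProperOff {e} c) (hs : G.IsStatic e') :
    G.pieceOf {e', e} (G.src (e', false)) ≠ G.pieceOf {e', e} (G.src (e', true)) := by
  intro hp
  by_cases hb : G.IsBridge e'
  · exact pieceOf_ne_of_isBridge hconn hb (G.pieceOf_eq_of_subset (by simp) hp)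
  · obtain ⟨c', h'⟩ := exists_isProperOff_of_isStatic hs hb
    obtain ⟨f, hf, -, hf'⟩ := exists_cut_of_isProperOff hne hG h' h
    refine hf (G.map_eq_of_pieceOf_eq hp f fun a ha => ?_)
    simp only [Set.mem_insert_iff, Set.mem_singleton_iff, not_or] at ha
    exact hf' a ha.1 ha.2

/-- Successive removal of edges each of which is a bridge once `e` is removed. -/
theorem isUnicellularOff_and_card_piece [Finite V] [Finite E] {e : E}
    (hconn : (G.minus {e}).Connected) (hu : G.IsUnicellularOff {e}) {Z : Set E} (he : e ∈ Z)
    (hsep : ∀ e' ∈ Z, e' ≠ e →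
      G.pieceOf {e', e} (G.src (e', false)) ≠ G.pieceOf {e', e} (G.src (e', true))) :
    G.IsUnicellularOff Z ∧ Nat.card (G.Piece Z) = Z.ncard := by
  classical
  -- The edge `e` goes first: the other edges are only known to separate once `e` is gone.
  have key : ∀ S : Finset E, e ∉ S → (S : Set E) ⊆ Z → G.IsUnicellularOff (insert e S) ∧
      Nat.card (G.Piece (insert e S)) = (insert e (S : Set E)).ncard := by
    intro S
    induction S using Finset.induction_on with
    | empty =>
      intro _ _
      rw [Finset.coe_empty, insert_empty_eq, Set.ncard_singleton]
      refine ⟨hu, ?_⟩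
      rw [connected_minus_iff] at hconn
      obtain ⟨h1, ⟨v⟩⟩ := hconn
      refine Nat.card_eq_one_iff_exists.mpr ⟨G.pieceOf _ v, fun c => ?_⟩
      obtain ⟨v', rfl⟩ := G.exists_pieceOf _ c
      exact h1 _ _
    | insert a S ha ih =>
      intro heS hS
      rw [Finset.mem_insert, not_or] at heS
      rw [Finset.coe_insert, Set.insert_subset_iff] at hS
      obtain ⟨h1, h2⟩ := ih heS.2 hS.2
      have ha' : a ∉ insert e (S : Set E) := by
        simpa [ha] using Ne.symm heS.1
      have hs : G.pieceOf (insert a (insert e (S : Set E))) (G.src (a, false)) ≠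
          G.pieceOf (insert a (insert e (S : Set E))) (G.src (a, true)) := fun h =>
        hsep a hS.1 (Ne.symm heS.1) (G.pieceOf_eq_of_subset
          (Set.insert_subset_insert (by simp)) h)
      rw [Finset.coe_insert, Set.insert_comm]
      exact ⟨G.isUnicellularOff_insert h1 ha' hs, by
        rw [G.card_piece_insert ha' hs, h2, Set.ncard_insert_of_notMem ha']⟩
  have := key (Z \ {e}).toFinite.toFinset (by simp) (by simp)
  rwa [Set.Finite.coe_toFinset, Set.insert_sdiff_singleton, Set.insert_eq_of_mem he] at this

end TwoFaces

end RibbonGraph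

/-! ### Faces of the pieces and of the static graph -/

namespace RibbonGraph

section Pieces

variable {V E : Type*} {G : RibbonGraph V E}

/-- Skipping the half-edges of `Z` in the induced rotation amounts to letting the boundary walk pass
over them, so both walks are the same first return map. -/
theorem piece_faceNext_sameCycle_iff [Finite E] {Z : Set E} {c : G.Piece Z}
    (x y : {e : E | e ∉ Z ∧ G.pieceOf Z (G.src (e, false)) = c} × Bool) :
    (G.piece Z c).faceNext.SameCycle x y ↔
      (G.boundaryStep Z).SameCycle (x.1.1, x.2) (y.1.1, y.2) := by
  have h : (G.piece Z c).faceNext = Equiv.prodSubtypeFstEquivSubtypeProd.permCongr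
      (firstReturn (G.boundaryStep Z)
        (fun d : E × Bool => d.1 ∈ {e : E | e ∉ Z ∧ G.pieceOf Z (G.src (e, false)) = c})) := by
    refine Equiv.ext fun d => congrArg (Equiv.prodSubtypeFstEquivSubtypeProd (p := fun e : E =>
      e ∈ {e : E | e ∉ Z ∧ G.pieceOf Z (G.src (e, false)) = c})) ?_
    have hd := d.1.2
    refine firstReturn_eq_of_agree (fun z => G.pieceOf Z (G.src z) = c) ?_ ?_ ?_
    · exact (G.boundaryStep_of_notMem (d := (d.1.1, d.2)) hd.1).symm
    · rw [src_rot]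
      exact (G.pieceOf_eq Z d.1.1 hd.1 _ _).trans hd.2
    · intro z hz hzp
      have hzZ : z.1 ∈ Z := by
        by_contra hzZ
        exact hzp ⟨hzZ, (G.pieceOf_eq Z z.1 hzZ _ _).trans hz⟩
      exact ⟨(G.boundaryStep_of_mem hzZ).symm, by rwa [src_rot]⟩
  rw [h, Equiv.Perm.permCongr_sameCycle_iff, firstReturn_sameCycle_iff]
  rfl

theorem eq_of_isolated_in_piece [Finite E] {Z : Set E} {c : G.Piece Z}
    {v : {v : V | G.pieceOf Z v = c}} (hv : ∀ d, (G.piece Z c).src d ≠ v) {u : V}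
    (hu : G.pieceOf Z u = c) : u = v.1 := by
  have hends : ∀ (e : E) (b : Bool), e ∉ Z → G.src (e, b) ≠ v.1 := by
    intro e b he h
    refine hv (⟨e, he, ?_⟩, b) (Subtype.ext h)
    rw [G.pieceOf_eq Z e he false b, h]
    exact v.2
  have := G.map_eq_of_pieceOf_eq (hu.trans v.2.symm) (fun u => u = v.1)
    (fun e he => by simp [hends e _ he])
  simpa using this

theorem card_face_piece [Finite E] {Z : Set E} (hu : G.IsUnicellularOff Z) (c : G.Piece Z) :
    Nat.card (G.piece Z c).Face = 1 := by
  by_cases hE : Nonempty {e : E | e ∉ Z ∧ G.pieceOf Z (G.src (e, false)) = c}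
  · obtain ⟨e⟩ := hE
    refine Nat.card_eq_one_iff_exists.mpr ⟨Sum.inl (Quotient.mk _ (e, false)), ?_⟩
    rintro (q | ⟨v, hv⟩)
    · induction q using Quotient.inductionOn with
      | _ d =>
        refine congrArg Sum.inl (Quotient.sound ((piece_faceNext_sameCycle_iff _ _).mpr
          (hu _ _ ?_)))
        rw [G.pieceOf_eq Z d.1.1 d.1.2.1 _ false]
        exact d.1.2.2.trans e.2.2.symm
    · exact absurd (Subtype.ext (eq_of_isolated_in_piece hv e.2.2)) (hv (e, false))
  · rw [not_nonempty_iff] at hE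
    obtain ⟨v, hv⟩ := G.exists_pieceOf Z c
    refine Nat.card_eq_one_iff_exists.mpr
      ⟨Sum.inr ⟨⟨v, hv⟩, fun d => isEmptyElim d.1⟩, ?_⟩
    rintro (q | ⟨u, hu⟩)
    · induction q using Quotient.inductionOn with
      | _ d => exact isEmptyElim d.1
    · exact congrArg Sum.inr (Subtype.ext (Subtype.ext (eq_of_isolated_in_piece hu hv).symm))

theorem isBipartite_piece [Finite E] {Z : Set E} {c : V → Bool} (h : G.IsProperOff Z c)
    (p : G.Piece Z) : (G.piece Z p).IsBipartite :=
  ⟨fun v => c v.1, fun e => h e.1 e.2.1⟩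

theorem boundaryNext_sameCycle_iff [Finite E] (Z : Set E) (x y : Z × Bool) :
    (G.boundaryNext Z).SameCycle x y ↔
      (G.boundaryStep Z).SameCycle (x.1.1, x.2) (y.1.1, y.2) := by
  rw [boundaryNext, Equiv.Perm.permCongr_sameCycle_iff, firstReturn_sameCycle_iff]
  rfl

/-- The ribbon graph obtained by contracting each piece to a vertex. -/
noncomputable def staticGraph [Finite E] {Z : Set E} (hu : G.IsUnicellularOff Z) :
    RibbonGraph (G.Piece Z) Z where
  src d := G.pieceOf Z (G.src (d.1.1, d.2))
  rot := G.boundaryNext Z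
  sameCycle_iff d d' := (boundaryNext_sameCycle_iff Z d d').trans
    ⟨G.pieceOf_eq_of_sameCycle, hu _ _⟩

theorem staticGraph_faceNext_sameCycle_iff [Finite E] {Z : Set E} (hu : G.IsUnicellularOff Z)
    (x y : Z × Bool) : (staticGraph hu).faceNext.SameCycle x y ↔
      G.faceNext.SameCycle (x.1.1, x.2) (y.1.1, y.2) := by
  have h : (staticGraph hu).faceNext = Equiv.prodSubtypeFstEquivSubtypeProd.permCongr
      (firstReturn G.faceNext (fun d : E × Bool => d.1 ∈ Z)) := by
    refine Equiv.ext fun d => congrArg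
      (Equiv.prodSubtypeFstEquivSubtypeProd (p := fun e : E => e ∈ Z)) ?_
    refine firstReturn_eq_of_agree (fun _ => True) ?_ trivial ?_
    · exact G.boundaryStep_of_mem (d := (d.1.1, !d.2)) d.1.2
    · exact fun z _ hz => ⟨G.boundaryStep_of_notMem hz, trivial⟩
  rw [h, Equiv.Perm.permCongr_sameCycle_iff, firstReturn_sameCycle_iff]
  rfl

theorem isConnected_staticGraph [Finite E] {Z : Set E} (hu : G.IsUnicellularOff Z)
    (hconn : G.IsConnected) : (staticGraph hu).IsConnected := by
  obtain ⟨h1, ⟨v₀⟩⟩ := (G.connected_minus_iff ∅).mp hconn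
  refine ((staticGraph hu).connected_minus_iff ∅).mpr ⟨fun c c' => ?_, ⟨G.pieceOf Z v₀⟩⟩
  obtain ⟨v, rfl⟩ := G.exists_pieceOf _ c
  obtain ⟨v', rfl⟩ := G.exists_pieceOf _ c'
  refine G.map_eq_of_pieceOf_eq (h1 v v')
    (fun v => (staticGraph hu).pieceOf ∅ (G.pieceOf Z v)) fun e _ => ?_
  by_cases he : e ∈ Z
  · exact (staticGraph hu).pieceOf_eq ∅ ⟨e, he⟩ (Set.notMem_empty _) false true
  · simp only [G.pieceOf_eq Z e he false true]

/-- Every face of `G` contains exactly one side of `e`, and `e` survives in the static graph.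
Connectedness and the presence of `e` exclude isolated vertices, which would count as further faces.
-/
theorem card_face_staticGraph [Finite E] {Z : Set E} (hu : G.IsUnicellularOff Z)
    (hconn : G.IsConnected) {e : E} (he : e ∈ Z)
    (hne : ¬ G.faceNext.SameCycle (e, false) (e, true))
    (hall : ∀ d, ∃ b, G.faceNext.SameCycle (e, b) d) :
    Nat.card (staticGraph hu).Face = 2 := by
  refine Nat.card_eq_two_iff.mpr ⟨Sum.inl (Quotient.mk _ (⟨e, he⟩, false)),
    Sum.inl (Quotient.mk _ (⟨e, he⟩, true)), fun h => ?_, Set.eq_univ_of_forall ?_⟩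
  · exact hne ((staticGraph_faceNext_sameCycle_iff hu _ _).mp
      (Quotient.exact (s := Equiv.Perm.SameCycle.setoid (staticGraph hu).faceNext)
        (Sum.inl_injective h)))
  · rintro (q | ⟨c, hc⟩)
    · induction q using Quotient.inductionOn with
      | _ d =>
        obtain ⟨b, hb⟩ := hall (d.1.1, d.2)
        have := congrArg (Sum.inl (β := {v // ∀ d, (staticGraph hu).src d ≠ v}))
          (Quotient.sound (s := Equiv.Perm.SameCycle.setoid (staticGraph hu).faceNext)
          ((staticGraph_faceNext_sameCycle_iff hu (⟨e, he⟩, b) d).mpr hb))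
        cases b
        · exact Or.inl this.symm
        · exact Or.inr this.symm
    · exfalso
      obtain ⟨v, rfl⟩ := G.exists_pieceOf _ c
      have h1 := ((G.connected_minus_iff ∅).mp hconn).1
      have := Eq.to_iff <| G.map_eq_of_pieceOf_eq (h1 v (G.src (e, false)))
        (fun u => G.pieceOf Z u = G.pieceOf Z v) (fun a _ => by
          by_cases ha : a ∈ Z
          · have h2 : ∀ b, G.pieceOf Z (G.src (a, b)) ≠ G.pieceOf Z v :=
              fun b => hc (⟨a, ha⟩, b)
            simp [h2]
          · rw [G.pieceOf_eq Z a ha false true])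
      exact hc (⟨e, he⟩, false) (this.mp rfl)

end Pieces

/-! ### Generic points of a wall -/

section Weights

variable {V E : Type*} [Fintype V] [Fintype E] {G : RibbonGraph V E}

theorem sum_mul_vertexParam (w : E → ℝ) (a : V → ℝ) :
    ∑ v, a v * G.vertexParam w v =
      ∑ e, (a (G.src (e, true)) + a (G.src (e, false))) * w e := by
  classical
  simp only [vertexParam, Finset.mul_sum]
  rw [Finset.sum_comm, Fintype.sum_prod_type]
  refine Finset.sum_congr rfl fun e _ => ?_
  simp [add_mul]

theorem pieceOf_involution_eq {Z : Set E} {c : V → Bool} (hc : G.IsProperOff Z c)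
    {W : Equiv.Perm V} (hW : ∀ v, W (W v) = v) (hW' : ∀ v, W v ≠ v) {w : E → ℝ}
    (hgen : IsGenericOnWall W (G.vertexParam w)) (hw : ∀ e ∈ Z, w e = 0) (v : V) :
    G.pieceOf Z (W v) = G.pieceOf Z v := by
  classical
  -- Colour signs on the piece of `v`: the ends of an edge outside `Z` cancel or both contribute
  -- zero.
  set a : V → ℝ := fun u =>
    if G.pieceOf Z u = G.pieceOf Z v then (if c u then 1 else -1) else 0 with ha
  have hrel : ∑ u, a u * G.vertexParam w u = 0 := by
    rw [sum_mul_vertexParam]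
    refine Finset.sum_eq_zero fun e _ => ?_
    by_cases he : e ∈ Z
    · rw [hw e he, mul_zero]
    · have h1 := G.pieceOf_eq Z e he false true
      have h2 := Bool.eq_not_of_ne (hc e he)
      simp only [ha, h1, h2]
      split_ifs <;> simp_all
  -- The relation is tested at the indicator of `{v, W v}`, a point of the wall.
  have h := hgen.2 a (fun u => by simp only [ha]; split_ifs <;> simp) hrel
    (fun u => if u = v ∨ u = W v then 1 else 0) (fun u => by
      have h1 : W u = v ↔ u = W v := ⟨fun h => by rw [← h, hW], fun h => by rw [h, hW]⟩
      have h2 : W u = W v ↔ u = v := W.injective.eq_iff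
      simp only [h1, h2, or_comm])
  have hsum : ∑ u, a u * (if u = v ∨ u = W v then (1 : ℝ) else 0) = a v + a (W v) := by
    rw [← Finset.sum_pair (hW' v).symm]
    simp only [mul_ite, mul_one, mul_zero, ← Finset.sum_filter]
    congr 1
    ext u
    simp
  rw [hsum] at h
  by_contra hne
  simp only [ha, if_neg hne, if_true] at h
  split_ifs at h <;> norm_num at h

end Weights

/-! ### The unique cycle of the static graph -/

section Cycles

variable {V E : Type*} {G : RibbonGraph V E}

/-- A two-valued function cannot change exactly once around a cycle. -/
theorem _root_.Fin.eq_add_one_of_forall_ne {m : ℕ} (g : Fin (m + 1) → Bool) (j : Fin (m + 1))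
    (h : ∀ i, i ≠ j → g i = g (i + 1)) : g j = g (j + 1) := by
  have h0 : ∑ i, ((g (i + 1)).toInt - (g i).toInt) = 0 := by
    rw [Finset.sum_sub_distrib, sub_eq_zero]
    exact Equiv.sum_comp (Equiv.addRight (1 : Fin (m + 1))) fun i => (g i).toInt
  rw [Finset.sum_eq_single j (fun i _ hi => by rw [h i hi, sub_self]) (by simp)] at h0
  revert h0
  generalize g j = p
  generalize g (j + 1) = q
  revert p q
  decide

/-- Being constant on pieces, `f` descends to the vertices of the static graph, where its changes
around a cycle cannot number exactly one. -/
theorem exists_ne_of_isCycleEdgeSet {Z C : Set E} (hC : (G.contracted Z).IsCycleEdgeSet C)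
    (f : V → Bool) (hf : ∀ e ∉ Z, f (G.src (e, false)) = f (G.src (e, true))) {e : E}
    (he : e ∈ C) (hfe : f (G.src (e, false)) ≠ f (G.src (e, true))) :
    ∃ e' ∈ C, e' ≠ e ∧ f (G.src (e', false)) ≠ f (G.src (e', true)) := by
  obtain ⟨m, x, a, -, ha, hlink, rfl⟩ := hC
  obtain ⟨j, rfl⟩ := he
  choose r hr using G.exists_pieceOf Z
  have hg : ∀ v, f (r (G.pieceOf Z v)) = f v :=
    fun v => G.map_eq_of_pieceOf_eq (hr _) f hf
  have hends : ∀ i, f (r (x i)) = f (r (x (i + 1))) ↔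
      f (G.src (a i, false)) = f (G.src (a i, true)) := by
    intro i
    obtain ⟨-, b, h1, h2⟩ := hlink i
    rw [← h1, ← h2, hg, hg]
    cases b
    · rfl
    · exact eq_comm
  by_contra! hcon
  refine hfe ((hends j).mp (Fin.eq_add_one_of_forall_ne (fun i => f (r (x i))) j fun i hi => ?_))
  exact (hends i).mpr (hcon _ ⟨i, rfl⟩ (ha.ne hi))

theorem _root_.Graph.IsCycleEdgeSet.nonempty {α β : Type*} {H : Graph α β} {C : Set β}
    (h : H.IsCycleEdgeSet C) : C.Nonempty := by
  obtain ⟨m, x, a, -, -, -, rfl⟩ := h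
  exact ⟨a 0, 0, rfl⟩

theorem _root_.Graph.IsCycleEdgeSet.subset {α β : Type*} {H : Graph α β} {C : Set β}
    (h : H.IsCycleEdgeSet C) : C ⊆ H.edgeSet := by
  obtain ⟨m, x, a, -, -, hl, rfl⟩ := h
  rintro _ ⟨i, rfl⟩
  exact (hl i).edge_mem

theorem exists_separating (Z : Set E) {v v' : V} (h : G.pieceOf Z v ≠ G.pieceOf Z v') :
    ∃ f : V → Bool, f v ≠ f v' ∧ ∀ e ∉ Z, f (G.src (e, false)) = f (G.src (e, true)) := by
  classical
  exact ⟨fun u => decide (G.pieceOf Z u = G.pieceOf Z v), by simp [h.symm],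
    fun e he => by simp only [G.pieceOf_eq Z e he false true]⟩

theorem isCycleEdgeSet_eq [Finite E] (hconn : G.IsConnected)
    (hG : ∀ c, ¬ G.IsProperOff ∅ c) {Z : Set E} (hZ : ∀ e ∈ Z, G.IsStatic e) {e : E}
    (he : e ∈ Z) {c : V → Bool} (hc : G.IsProperOff {e} c) {C : Set E}
    (hC : (G.contracted Z).IsCycleEdgeSet C) : C = {e | e ∈ Z ∧ ¬ G.IsBridge e} := by
  have hCZ : C ⊆ Z := hC.subset
  have heC : e ∈ C := by
    obtain ⟨a, ha⟩ := hC.nonempty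
    by_cases hae : a = e
    · rwa [← hae]
    -- Here `f` can change only at `a` and `e`, so the second change on the cycle is at `e`.
    obtain ⟨f, hfa, hf⟩ := exists_separating _
      (pieceOf_pair_ne hconn hG hae hc (hZ a (hCZ ha)))
    obtain ⟨a', ha', hne, hfa'⟩ := exists_ne_of_isCycleEdgeSet hC f
      (fun e' he' => hf e' (by rintro (rfl | rfl); exacts [he' (hCZ ha), he' he])) ha hfa
    by_cases hae' : a' = e
    · rwa [← hae']
    · exact absurd (hf a' (by simp [hne, hae'])) hfa'
  refine Set.Subset.antisymm (fun a ha => ⟨hCZ ha, fun hb => ?_⟩) ?_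
  · obtain ⟨f, hfa, hf⟩ := exists_separating _ (pieceOf_ne_of_isBridge hconn hb)
    obtain ⟨a', -, hne, hfa'⟩ := exists_ne_of_isCycleEdgeSet hC f
      (fun e' he' => hf e' (by rintro rfl; exact he' (hCZ ha))) ha hfa
    exact hfa' (hf a' hne)
  · rintro a ⟨haZ, hab⟩
    by_cases hae : a = e
    · rwa [hae]
    obtain ⟨c', hc'⟩ := exists_isProperOff_of_isStatic (hZ a haZ) hab
    obtain ⟨f, -, hfe, hf⟩ := exists_cut_of_isProperOff hae hG hc' hc
    obtain ⟨a', ha', hne, hfa'⟩ := exists_ne_of_isCycleEdgeSet hC f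
      (fun e' he' => hf e' (by rintro rfl; exact he' haZ) (by rintro rfl; exact he' he)) heC hfe
    by_cases haa : a' = a
    · rwa [← haa]
    · exact absurd (hf a' haa hne) hfa'

theorem exists_isCycleEdgeSet {Z : Set E} {e : E} (he : e ∈ Z)
    (hconn : (G.minus {e}).Connected) : ∃ C, (G.contracted Z).IsCycleEdgeSet C := by
  classical
  -- The static graph without `e` and without loops, which do not affect reachability. If `e` is
  -- itself a loop, the path below has length zero.
  let K : SimpleGraph (G.Piece Z) :=
    { Adj := fun c c' => c ≠ c' ∧ ∃ a, a ≠ e ∧ (G.contracted Z).IsLink a c c'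
      symm := ⟨fun c c' h => ⟨h.1.symm, h.2.imp fun a ha => ⟨ha.1, ha.2.symm⟩⟩⟩
      loopless := ⟨fun c h => h.1 rfl⟩ }
  have hreach : K.Reachable (G.pieceOf Z (G.src (e, true))) (G.pieceOf Z (G.src (e, false))) := by
    refine SimpleGraph.ConnectedComponent.eq.mp (G.map_eq_of_pieceOf_eq
      (((G.connected_minus_iff {e}).mp hconn).1 (G.src (e, true)) (G.src (e, false)))
      (fun v => K.connectedComponentMk (G.pieceOf Z v)) fun a ha => ?_)
    by_cases haZ : G.pieceOf Z (G.src (a, false)) = G.pieceOf Z (G.src (a, true))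
    · simp only [haZ]
    · have : a ∈ Z := by
        by_contra h
        exact haZ (G.pieceOf_eq Z a h _ _)
      exact SimpleGraph.ConnectedComponent.sound
        (SimpleGraph.Adj.reachable ⟨haZ, a, ha, this, false, rfl, rfl⟩)
  obtain ⟨p, hp⟩ := hreach.exists_isPath
  have hadj : ∀ i : ℕ, ∃ a, i < p.length →
      a ≠ e ∧ (G.contracted Z).IsLink a (p.getVert i) (p.getVert (i + 1)) := by
    intro i
    by_cases hi : i < p.length
    · exact (p.adj_getVert_succ hi).2.imp fun a ha _ => ha
    · exact ⟨e, fun h => absurd h hi⟩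
  choose a ha using hadj
  have hinj : ∀ {i j : ℕ}, i ≤ p.length → j ≤ p.length → p.getVert i = p.getVert j → i = j :=
    fun hi hj h => hp.getVert_injOn hi hj h
  refine ⟨_, p.length, fun i => p.getVert i,
    -- The last index, `p.length`, carries the closing edge `e`.
    fun i => if (i : ℕ) < p.length then a i else e, ?_, ?_, ?_, rfl⟩
  · intro i j h
    exact Fin.ext (hinj (by omega) (by omega) h)
  · intro i j h
    simp only at h
    split_ifs at h with hi hj hj
    · have h1 := (ha i hi).2
      rw [h] at h1
      rcases h1.eq_and_eq_or_eq_and_eq (ha j hj).2 with ⟨h2, -⟩ | ⟨h2, h3⟩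
      · exact Fin.ext (hinj (by omega) (by omega) h2)
      · have h4 := hinj (by omega) (by omega) h2
        have h5 := hinj (by omega) (by omega) h3
        omega
    · exact absurd h (ha i hi).1
    · exact absurd h.symm (ha j hj).1
    · exact Fin.ext (by omega)
  · intro i
    by_cases hi : (i : ℕ) < p.length
    · have h1 : ((i + 1 : Fin (p.length + 1)) : ℕ) = i + 1 :=
        Fin.val_add_one_of_lt (by rw [Fin.lt_def, Fin.val_last]; exact hi)
      simp only [if_pos hi, h1]
      exact (ha i hi).2
    · have h1 : i = Fin.last p.length := Fin.ext (by rw [Fin.val_last]; omega)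
      subst h1
      simp only [Fin.val_last, lt_irrefl, if_false, Fin.last_add_one, Fin.val_zero,
        SimpleGraph.Walk.getVert_length, SimpleGraph.Walk.getVert_zero]
      exact ⟨he, false, rfl, rfl⟩

end Cycles

end RibbonGraph

theorem proposition6p5 {V E : Type*} [Fintype V] [Fintype E] (G : RibbonGraph V E)
    (hconn : G.IsConnected)
    (μ : Fin 2 → ℤ) (hodd : ∀ i, Odd (μ i))
    (face : Fin 2 ≃ G.Face) (hface : ∀ i, (G.faceDegree (face i) : ℤ) = μ i + 2)
    (Z : Set E) (hZ : ∀ e ∈ Z, G.IsStatic e)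
    (e₀ : E) (he₀ : e₀ ∈ Z) (hnb : ¬ G.IsBridge e₀) :
    (∃ C : Set E, (G.contracted Z).IsCycleEdgeSet C ∧
      (∀ C' : Set E, (G.contracted Z).IsCycleEdgeSet C' → C' = C) ∧
      C = {e | e ∈ Z ∧ ¬ G.IsBridge e}) ∧
    (∀ c : G.Piece Z, (G.piece Z c).IsBipartite ∧ Nat.card (G.piece Z c).Face = 1) ∧
    (∃ R : RibbonGraph (G.Piece Z) Z,
      (∀ d : Z × Bool, R.src d = G.pieceOf Z (G.src (d.1.1, d.2))) ∧
      R.rot = G.boundaryNext Z ∧ R.IsPlanar) ∧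
    (∀ W : Equiv.Perm V, (∀ v, W (W v) = v) → (∀ v, W v ≠ v) →
      ∀ w : E → ℝ, IsGenericOnWall W (G.vertexParam w) → (∀ e ∈ Z, w e = 0) →
        ∀ v, G.pieceOf Z (W v) = G.pieceOf Z v) := by
  have hdeg : ∀ i, Odd (G.faceDegree (face i)) := fun i => by
    have h : Odd (G.faceDegree (face i) : ℤ) := by
      rw [hface i]
      exact (hodd i).add_even even_two
    exact_mod_cast h
  have hG := RibbonGraph.not_isProperOff_empty (hdeg 0)
  obtain ⟨c, hc⟩ := RibbonGraph.exists_isProperOff_of_isStatic (hZ e₀ he₀) hnb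
  have hcZ : G.IsProperOff Z c := fun e he => hc e (by rintro rfl; exact he he₀)
  obtain ⟨hu, hcard⟩ := RibbonGraph.isUnicellularOff_and_card_piece (not_not.mp hnb)
    (RibbonGraph.isUnicellularOff_singleton face hdeg hc) he₀
    (fun e he hne => RibbonGraph.pieceOf_pair_ne hconn hG hne hc (hZ e he))
  have hcycle := fun C => RibbonGraph.isCycleEdgeSet_eq hconn hG hZ he₀ hc (C := C)
  refine ⟨?_, fun p => ⟨RibbonGraph.isBipartite_piece hcZ p, RibbonGraph.card_face_piece hu p⟩,
    ⟨RibbonGraph.staticGraph hu, fun d => rfl, rfl,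
      RibbonGraph.isConnected_staticGraph hu hconn, ?_⟩,
    fun W hW hW' w hgen hw v => RibbonGraph.pieceOf_involution_eq hcZ hW hW' hgen hw v⟩
  · obtain ⟨C, hC⟩ := RibbonGraph.exists_isCycleEdgeSet he₀ (not_not.mp hnb)
    exact ⟨C, hC, fun C' hC' => (hcycle C' hC').trans (hcycle C hC).symm, hcycle C hC⟩
  · rw [RibbonGraph.card_face_staticGraph hu hconn he₀
      (RibbonGraph.not_sameCycle_sides face hdeg hc)
      (RibbonGraph.exists_side_sameCycle face hdeg hc), hcard, Nat.card_coe_set_eq]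
    simp
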